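/- Let $n\ge 1$ and let $D_1,\dots,D_{n+1}\subset\mathbb P^n(\mathbb C)$ be hypersurfaces defined by homogeneous polynomials $Q_1,\dots,Q_{n+1}\in\mathbb C[z_0,\dots,z_n]$ of degrees $d_1,\dots,d_{n+1}\ge 1$ with $\sum_{i=1}^{n+1} d_i\ge n+2$. Let $J=\det\big(\partial(Q_1,\dots,Q_{n+1})/\partial(z_0,\dots,z_n)\big)$ be the Jacobian determinant and let $\mathcal V=\{J=0\}\subset\mathbb P^n(\mathbb C)$. Assume that $D_1,\dots,D_{n+1}$ and $\mathcal V$ are in general position, i.e. any $n+1$ of these $n+2$ sets have empty intersection. Put $d=\operatorname{lcm}(d_1,\dots,d_{n+1})$ and $m_i=d/d_i$, let $$F=[Q_1^{m_1}:\dots:Q_{n+1}^{m_{n+1}}]\colon\mathbb P^n(\mathbb C)\to\mathbb P^n(\mathbb C),$$ and let $\mathcal W=F(\mathcal V)$. For a holomorphic curve $h\colon\mathbb C\to\mathbb P^n(\mathbb C)$ and an effective divisor $E$ with homogeneous equation $P$, let $\operatorname{ord}_z h^*E\in\mathbb N\cup\{\infty\}$ be the vanishing order at $z$ of $P\circ\tilde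 h$, where $\tilde h$ is any holomorphic lift of $h$ to $\mathbb C^{n+1}\setminus\{0\}$ near $z$ (the order is $\infty$ if this function vanishes identically near $z$). Take $\mathcal V$ as the divisor with equation $J$ (with multiplicities). Then $\mathcal W$ is a hypersurface, i.e. it is the zero set of a square-free homogeneous polynomial $R$; take $\mathcal W$ as the reduced divisor with equation $R$. Moreover, there is a proper subvariety $\mathcal Z\subsetneq\mathcal V$ (a Zariski closed subset, with $\mathcal V\setminus\mathcal Z$ Zariski dense in $\mathcal V$) such that for every holomorphic curve $f\colon\mathbb C\to\mathbb P^n(\mathbb C)$, with $g=F\circ f$, and for every $z\in f^{-1}(\mathcal V\setminus\mathcal Z)$, $$\operatorname{ord}_z f^*\mathcal V\le\operatorname{ord}_z g^*\mathcal W-1,$$ with the convention $\infty-1=\infty$. -/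

import Mathlib

open scoped LinearAlgebra.Projectivization Topology

noncomputable section

/-- Complex projective `n`-space `ℙⁿ(ℂ)`. -/
abbrev CProj (n : ℕ) : Type := ℙ ℂ (Fin (n + 1) → ℂ)

/-- Polynomials in the homogeneous coordinates `z₀, …, zₙ` of `ℙⁿ(ℂ)`. -/
abbrev CoordPoly (n : ℕ) : Type := MvPolynomial (Fin (n + 1)) ℂ

/-- The zero set in `ℙⁿ(ℂ)` of a homogeneous polynomial. For homogeneous `P` the condition does
not depend on the chosen representative of the point. -/
def projZeros {n : ℕ} (P : CoordPoly n) : Set (CProj n) :=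
  {p | MvPolynomial.eval p.rep P = 0}

/-- Zariski closed subsets of `ℙⁿ(ℂ)`: common zero sets of homogeneous polynomials. -/
def IsProjAlgebraic {n : ℕ} (Z : Set (CProj n)) : Prop :=
  ∃ S : Set (CoordPoly n), (∀ P ∈ S, ∃ k : ℕ, P.IsHomogeneous k) ∧ Z = ⋂ P ∈ S, projZeros P

/-- `Z` is a proper subvariety of the closed algebraic set `V`: it is a Zariski closed subset of
`V`, different from `V`, and `V \ Z` is Zariski dense in `V` (so that, for reducible `V`, the set
`Z` contains no irreducible component of `V`). -/
def IsProperSubvariety {n : ℕ} (Z V : Set (CProj n)) : Prop :=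
  IsProjAlgebraic Z ∧ Z ⊂ V ∧ ∀ T : Set (CProj n), IsProjAlgebraic T → V \ Z ⊆ T → V ⊆ T

/-- `R` is a reduced equation of the hypersurface `W`. (It is then unique up to a nonzero constant,
and defines `W` as a reduced effective divisor.) -/
def IsReducedEquation {n : ℕ} (R : CoordPoly n) (W : Set (CProj n)) : Prop :=
  (∃ k : ℕ, R.IsHomogeneous k) ∧ Squarefree R ∧ projZeros R = W

/-- A family of subsets of `ℙⁿ(ℂ)` is in general position if any `n + 1` of its members have
empty intersection. -/
def InGeneralPosition {n : ℕ} {ι : Type} (D : ι → Set (CProj n)) : Prop :=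
  ∀ s : Finset ι, s.card = n + 1 → ⋂ i ∈ s, D i = ∅

/-- The Jacobian determinant `det ∂(Q₁, …, Qₙ₊₁) / ∂(z₀, …, zₙ)`. -/
def jacobianPoly {n : ℕ} (Q : Fin (n + 1) → CoordPoly n) : CoordPoly n :=
  (Matrix.of fun i j => MvPolynomial.pderiv j (Q i)).det

/-- The `n + 2` polynomials `Q₁, …, Qₙ₊₁` and their Jacobian determinant. -/
def withJacobian {n : ℕ} (Q : Fin (n + 1) → CoordPoly n) : Option (Fin (n + 1)) → CoordPoly n
  | none => jacobianPoly Q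
  | some i => Q i

/-- The exponents `mᵢ = lcm(d₁, …, dₙ₊₁) / dᵢ`. -/
def lcmExponent {n : ℕ} (d : Fin (n + 1) → ℕ) (i : Fin (n + 1)) : ℕ :=
  Finset.univ.lcm d / d i

/-- The vector `(Q₁(v)^{m₁}, …, Qₙ₊₁(v)^{mₙ₊₁})`. -/
def endoVec {n : ℕ} (d : Fin (n + 1) → ℕ) (Q : Fin (n + 1) → CoordPoly n)
    (v : Fin (n + 1) → ℂ) : Fin (n + 1) → ℂ :=
  fun i => (MvPolynomial.eval v (Q i)) ^ lcmExponent d i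

theorem endoVec_ne_zero {n : ℕ} (d : Fin (n + 1) → ℕ) (Q : Fin (n + 1) → CoordPoly n)
    (h : InGeneralPosition fun o => projZeros (withJacobian Q o)) (p : CProj n) :
    endoVec d Q p.rep ≠ 0 := by
  intro h0
  have h1 := h (Finset.univ.map Function.Embedding.some) (by simp)
  have h2 : p ∈ ⋂ i ∈ Finset.univ.map (Function.Embedding.some (α := Fin (n + 1))),
      projZeros (withJacobian Q i) := by
    simp only [Set.mem_iInter, Finset.mem_map, Finset.mem_univ, true_and]
    rintro _ ⟨i, rfl⟩
    exact eq_zero_of_pow_eq_zero (congrFun h0 i)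
  rw [h1] at h2
  exact h2

/-- The endomorphism `F = [Q₁^{m₁} : ⋯ : Qₙ₊₁^{mₙ₊₁}]` of `ℙⁿ(ℂ)`; the `Qᵢ` have no common zero
since they are in general position. -/
def projEndo {n : ℕ} (d : Fin (n + 1) → ℕ) (Q : Fin (n + 1) → CoordPoly n)
    (h : InGeneralPosition fun o => projZeros (withJacobian Q o)) (p : CProj n) : CProj n :=
  Projectivization.mk ℂ (endoVec d Q p.rep) (endoVec_ne_zero d Q h p)

/-- `φ` is a holomorphic lift of `f` to `ℂⁿ⁺¹ \ {0}` near `z`. -/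
def IsLocalLift {n : ℕ} (f : ℂ → CProj n) (z : ℂ) (φ : ℂ → Fin (n + 1) → ℂ) : Prop :=
  AnalyticAt ℂ φ z ∧ ∀ᶠ w in 𝓝 z, ∃ hw : φ w ≠ 0, f w = Projectivization.mk ℂ (φ w) hw

/-- `f : ℂ → ℙⁿ(ℂ)` is holomorphic, i.e. it lifts holomorphically to `ℂⁿ⁺¹ \ {0}` near every
point. -/
def IsEntireCurve {n : ℕ} (f : ℂ → CProj n) : Prop :=
  ∀ z : ℂ, ∃ φ : ℂ → Fin (n + 1) → ℂ, IsLocalLift f z φ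

/-- The order `ord_z f^*D` at `z` of the pull-back under a holomorphic `f` of the effective divisor
`D` with homogeneous equation `P`: the vanishing order at `z` of `P ∘ φ` for a local holomorphic
lift `φ` of `f`. All lifts give the same value (they differ by a nonvanishing holomorphic factor).
It is `⊤` if `P ∘ φ` vanishes identically near `z`. -/
def ordPullback {n : ℕ} (f : ℂ → CProj n) (P : CoordPoly n) (z : ℂ) : ℕ∞ :=
  ⨅ (φ : ℂ → Fin (n + 1) → ℂ) (_ : IsLocalLift f z φ),
    analyticOrderAt (fun w => MvPolynomial.eval (φ w) P) z

end

open MvPolynomial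

/-! Let `G` be the map of affine space with coordinates `Q i ^ m i`. Its only zero is the origin, so
`k[X]` is integral over `k[G]` (`aeval_isIntegral`), and `J` divides `det DG`. For a prime factor
`p` of `J`, the ideal `(p)` contracts along `G` to a principal prime `(r)`, and `G` maps `{p = 0}`
onto `{r = 0}`. The radical of the product of these `r` is the reduced equation `R` of `𝒲`. The
inequality is a ramification estimate (`pow_succ_dvd_aeval_of_pow_dvd_det`): `p ^ e ∣ det DG` forces
`p ^ (e + 1) ∣ r ∘ G`. Write `r ∘ G = p ^ m * u` with `p ∤ u`. The combination of the rows of `DG`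
with coefficients `∂ᵢr ∘ G` is `d(p ^ m * u)`, so `det DG` has order at most `m - 1` along `p`
unless the determinant with one row replaced by `dp` vanishes on `{p = 0}`. That would give a
nonzero derivation into the function field of `{p = 0}` killing every `G i`, which integrality and
characteristic zero forbid. Over all `p` this gives `J * radical J ∣ R ∘ G`. The factor `radical J`
vanishes on `𝒱` and supplies the extra 1 at each of its points. -/

/-! ### Derivations, Jacobians and the ramification estimate. -/

theorem Derivation.aeval_eq_sum_pderiv {k σ A M : Type*} [Fintype σ] [CommRing k] [CommRing A]
    [Algebra k A] [AddCommGroup M] [Module A M] [Module k M]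
    (D : Derivation k A M) (G : σ → A) (r : MvPolynomial σ k) :
    D (aeval G r) = ∑ i, aeval G (pderiv i r) • D (G i) := by
  classical
  induction r using MvPolynomial.induction_on with
  | C a => simp
  | add p q hp hq => simp [hp, hq, add_smul, Finset.sum_add_distrib]
  | mul_X p j hp =>
    simp only [map_mul, aeval_X, Derivation.leibniz, hp, pderiv_X, smul_eq_mul, map_add, add_smul,
      Finset.sum_add_distrib, Finset.smul_sum, mul_smul, Pi.single_apply, apply_ite, map_one,
      map_zero]
    simp

/-- A derivation into a field of characteristic zero which factors through the image of the ring in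
the field and vanishes on a subring over which the ring is integral vanishes. -/
theorem Derivation.eq_zero_of_isIntegral {k A B K : Type*} [CommRing k] [CommRing A] [Algebra k A]
    [CommRing B] [Field K] [CharZero K] [Algebra A K] [Algebra k K]
    (D : Derivation k A K) (φ : B →+* A) (hφ : φ.IsIntegral)
    (hker : ∀ a, algebraMap A K a = 0 → D a = 0) (hB : ∀ b, D (φ b) = 0) : D = 0 := by
  have hD : ∀ (s : A) (q : Polynomial B), D (q.eval₂ φ s) = q.derivative.eval₂ φ s • D s := by
    intro s q
    induction q using Polynomial.induction_on' with
    | add p q hp hq => simp [Polynomial.eval₂_add, hp, hq, add_smul]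
    | monomial m a =>
      simp [Polynomial.derivative_monomial, Polynomial.eval₂_monomial, hB, Derivation.leibniz_pow,
        mul_smul, Derivation.leibniz]
      rw [← nsmul_eq_mul, Nat.cast_smul_eq_nsmul, smul_comm, smul_comm m,
        smul_comm (s ^ (m - 1)) (φ a)]
  -- Descent on an equation `q` for the image of `s`: if `q'(s) ≠ 0` in `K`, then `q'(s) • D s = 0`
  -- gives `D s = 0`; otherwise `q'` is an equation of lower degree, nonzero by characteristic zero.
  have key : ∀ (N : ℕ) (s : A) (q : Polynomial B), q.natDegree ≤ N →
      algebraMap A K (q.eval₂ φ s) = 0 → q.map ((algebraMap A K).comp φ) ≠ 0 → D s = 0 := by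
    intro N
    induction N with
    | zero =>
      intro s q hq h0 hne
      rw [Polynomial.eq_C_of_natDegree_le_zero hq] at h0 hne
      simp only [Polynomial.eval₂_C] at h0
      simp [h0] at hne
    | succ N ih =>
      intro s q hq h0 hne
      by_cases h1 : algebraMap A K (q.derivative.eval₂ φ s) = 0
      · refine ih s q.derivative ((Polynomial.natDegree_derivative_le q).trans (by omega)) h1 ?_
        intro h2
        rw [← Polynomial.derivative_map] at h2
        have h3 := Polynomial.derivative_eq_zero.1 h2
        rw [Polynomial.eq_C_of_natDegree_eq_zero h3] at hne
        rw [Polynomial.hom_eval₂, ← Polynomial.eval_map,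
          Polynomial.eq_C_of_natDegree_eq_zero h3, Polynomial.eval_C] at h0
        simp [h0] at hne
      · have h2 := hD s q
        rw [hker _ h0, Algebra.smul_def] at h2
        exact (mul_eq_zero.1 h2.symm).resolve_left h1
  ext s
  obtain ⟨q, hq, h0⟩ := hφ s
  exact key _ s q le_rfl (by rw [h0, map_zero]) (hq.map _).ne_zero

/-- The Jacobian matrix of a family of polynomials. -/
noncomputable def MvPolynomial.jacobianMatrix {σ τ k : Type*} [CommRing k]
    (G : τ → MvPolynomial σ k) :
    Matrix τ σ (MvPolynomial σ k) :=
  Matrix.of fun i j => pderiv j (G i)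

section

variable {σ k : Type*} [Fintype σ] [Field k]

theorem mkDerivation_eq_sum {K : Type*} [Field K] [Algebra (MvPolynomial σ k) K] [Algebra k K]
    [IsScalarTower k (MvPolynomial σ k) K] (v : σ → K) (f : MvPolynomial σ k) :
    mkDerivation k v f = ∑ j, algebraMap _ K (pderiv j f) * v j := by
  have h := (mkDerivation k v).aeval_eq_sum_pderiv (X : σ → MvPolynomial σ k) f
  simpa [Algebra.smul_def] using h

variable [CharZero k]

/-- The vector `v` is read as the derivation `X i ↦ v i`, which kills `k[G]`. Below, `K` is the
function field of the whole space or of a hypersurface; in the second case `hker` says that `v` is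
tangent to it. -/
theorem eq_zero_of_mulVec_eq_zero {K : Type*} [Field K] [Algebra (MvPolynomial σ k) K]
    [Algebra k K] [IsScalarTower k (MvPolynomial σ k) K] (G : σ → MvPolynomial σ k)
    (hG : (aeval G : MvPolynomial σ k →ₐ[k] MvPolynomial σ k).toRingHom.IsIntegral)
    (v : σ → K) (hker : ∀ a, algebraMap _ K a = 0 → mkDerivation k v a = 0)
    (hv : ∀ i, mkDerivation k v (G i) = 0) : v = 0 := by
  have : CharZero K := charZero_of_injective_algebraMap (algebraMap k K).injective
  have h := (mkDerivation k v).eq_zero_of_isIntegral _ hG hker fun b => by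
    simpa [hv] using (mkDerivation k v).aeval_eq_sum_pderiv G b
  ext i
  rw [← mkDerivation_X k v i, h]
  rfl

variable [DecidableEq σ]

theorem det_jacobianMatrix_ne_zero (G : σ → MvPolynomial σ k)
    (hG : (aeval G : MvPolynomial σ k →ₐ[k] MvPolynomial σ k).toRingHom.IsIntegral) :
    (jacobianMatrix G).det ≠ 0 := by
  intro h0
  let K := FractionRing (MvPolynomial σ k)
  have h1 : ((jacobianMatrix G).map (algebraMap _ K)).det = 0 := by
    rw [← RingHom.mapMatrix_apply, ← RingHom.map_det, h0, map_zero]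
  obtain ⟨v, hv0, hv⟩ := Matrix.exists_mulVec_eq_zero_iff.2 h1
  refine hv0 (eq_zero_of_mulVec_eq_zero G hG v ?_ ?_)
  · intro a ha
    rw [(IsFractionRing.injective (MvPolynomial σ k) K) (ha.trans (map_zero _).symm), map_zero]
  · intro i
    rw [mkDerivation_eq_sum]
    exact congrFun hv i

theorem not_dvd_det_updateRow (G : σ → MvPolynomial σ k)
    (hG : (aeval G : MvPolynomial σ k →ₐ[k] MvPolynomial σ k).toRingHom.IsIntegral)
    {p : MvPolynomial σ k} (hp : Prime p) {r : MvPolynomial σ k} (hr : p ∣ aeval G r) {i₀ : σ}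
    (hi : ¬ p ∣ aeval G (pderiv i₀ r)) :
    ¬ p ∣ ((jacobianMatrix G).updateRow i₀ fun j => pderiv j p).det := by
  intro h0
  let I := Ideal.span {p}
  have : I.IsPrime := (Ideal.span_singleton_prime hp.ne_zero).2 hp
  let K := FractionRing (MvPolynomial σ k ⧸ I)
  have hker : ∀ a, algebraMap (MvPolynomial σ k) K a = 0 ↔ p ∣ a := by
    intro a
    rw [IsScalarTower.algebraMap_apply (MvPolynomial σ k) (MvPolynomial σ k ⧸ I) K,
      map_eq_zero_iff _ (IsFractionRing.injective (MvPolynomial σ k ⧸ I) K), Ideal.Quotient.algebraMap_eq,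
      Ideal.Quotient.eq_zero_iff_mem, Ideal.mem_span_singleton]
  have h1 : (((jacobianMatrix G).updateRow i₀ fun j => pderiv j p).map (algebraMap _ K)).det = 0 := by
    rw [← RingHom.mapMatrix_apply, ← RingHom.map_det, hker]
    exact h0
  obtain ⟨v, hv0, hv⟩ := Matrix.exists_mulVec_eq_zero_iff.2 h1
  have hvp : mkDerivation k v p = 0 := by
    rw [mkDerivation_eq_sum]
    simpa [Matrix.mulVec, dotProduct] using congrFun hv i₀
  have hv' : ∀ i ≠ i₀, mkDerivation k v (G i) = 0 := by
    intro i hi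
    rw [mkDerivation_eq_sum]
    simpa [Matrix.mulVec, dotProduct, hi, jacobianMatrix] using congrFun hv i
  have hdvd : ∀ a, p ∣ a → mkDerivation k v a = 0 := by
    rintro _ ⟨b, rfl⟩
    rw [Derivation.leibniz, hvp, smul_zero, add_zero, Algebra.smul_def, (hker p).2 dvd_rfl,
      zero_mul]
  refine hv0 (eq_zero_of_mulVec_eq_zero G hG v (fun a ha => hdvd a ((hker a).1 ha)) fun i => ?_)
  -- Row `i₀` is not in the kernel equations, but `r ∘ G` is zero on `{p = 0}`: in the chain rule
  -- only the term of `G i₀` survives, with a coefficient that is nonzero modulo `p`.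
  by_cases h : i = i₀
  · subst h
    have h2 := (mkDerivation k v).aeval_eq_sum_pderiv G r
    rw [hdvd _ hr, Finset.sum_eq_single i (fun j _ hj => by rw [hv' j hj, smul_zero])
      (fun h => absurd (Finset.mem_univ i) h),
      Algebra.smul_def] at h2
    exact (mul_eq_zero.1 h2.symm).resolve_left (mt (hker _).1 hi)
  · exact hv' i h

/-- The ramification estimate: the order of the Jacobian determinant along a prime divisor is
smaller than the order of the pull-back of an equation of the image. -/
theorem pow_succ_dvd_aeval_of_pow_dvd_det (G : σ → MvPolynomial σ k)
    (hG : (aeval G : MvPolynomial σ k →ₐ[k] MvPolynomial σ k).toRingHom.IsIntegral)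
    {p : MvPolynomial σ k} (hp : Prime p) {r : MvPolynomial σ k} (hr : p ∣ aeval G r)
    (hr0 : aeval G r ≠ 0) {i₀ : σ} (hi : ¬ p ∣ aeval G (pderiv i₀ r)) {e : ℕ}
    (he : p ^ e ∣ (jacobianMatrix G).det) : p ^ (e + 1) ∣ aeval G r := by
  obtain ⟨u, hu, hm⟩ := (FiniteMultiplicity.of_prime_left hp hr0).exists_eq_pow_mul_and_not_dvd
  generalize multiplicity p (aeval G r) = m at hu
  suffices h : e < m by rw [hu]; exact Dvd.dvd.mul_right (pow_dvd_pow p h) u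
  by_contra! hle
  obtain _ | m := m
  · rw [hu, pow_zero, one_mul] at hr
    exact hm hr
  have hpm := (pow_dvd_pow p hle).trans he
  -- From here the multiplicity is `m + 1`, and the row combination is the differential of `p ^ (m +
  -- 1) * u`.
  have hrow : (∑ i, aeval G (pderiv i r) • jacobianMatrix G i) =
      p ^ m • (((m + 1 : ℕ) * u) • (fun j => pderiv j p) + p • fun j => pderiv j u) := by
    ext1 j
    have h2 := (pderiv j).aeval_eq_sum_pderiv G r
    rw [hu] at h2
    simp only [Finset.sum_apply, Pi.smul_apply, jacobianMatrix, Matrix.of_apply, Pi.add_apply]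
    rw [← h2]
    simp only [Derivation.leibniz, Derivation.leibniz_pow, smul_eq_mul, nsmul_eq_mul,
      Nat.add_sub_cancel]
    ring
  have hdet := Matrix.det_updateRow_sum (jacobianMatrix G) i₀ fun i => aeval G (pderiv i r)
  rw [hrow, Matrix.det_updateRow_smul, Matrix.det_updateRow_add, Matrix.det_updateRow_smul,
    Matrix.det_updateRow_smul] at hdet
  have h3 := hpm.mul_left (aeval G (pderiv i₀ r))
  rw [← smul_eq_mul, ← hdet, pow_succ, mul_dvd_mul_iff_left (pow_ne_zero _ hp.ne_zero),
    dvd_add_left (dvd_mul_right p _)] at h3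
  rcases hp.dvd_or_dvd h3 with h4 | h4
  · rcases hp.dvd_or_dvd h4 with h5 | h5
    · rw [← map_natCast (C : k →+* MvPolynomial σ k)] at h5
      exact hp.not_isUnit (isUnit_of_dvd_unit h5
        ((isUnit_iff_ne_zero.2 (Nat.cast_ne_zero.2 m.succ_ne_zero)).map C))
    · exact hm h5
  · exact not_dvd_det_updateRow G hG hp hr hi h4

end

/-! ### Homogeneous polynomials and finiteness of `G`. -/

section

variable {σ k : Type*} [Field k]

/-- Under `X i ↦ X i * t` homogeneous components become coefficients of `t`. The product becomes a
monomial in `t`; degrees and trailing degrees add, so they agree for each factor. -/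
theorem MvPolynomial.IsHomogeneous.of_mul_left {f g : MvPolynomial σ k} {n : ℕ}
    (h : (f * g).IsHomogeneous n)
    (h0 : f * g ≠ 0) : ∃ m, f.IsHomogeneous m := by
  have hf : f ≠ 0 := left_ne_zero_of_mul h0
  have hg : g ≠ 0 := right_ne_zero_of_mul h0
  let Φ : MvPolynomial σ k →ₐ[k] Polynomial (MvPolynomial σ k) :=
    MvPolynomial.aeval fun i => Polynomial.C (X i) * Polynomial.X
  have hmon : ∀ s (c : k), Φ (monomial s c) = Polynomial.monomial s.degree (monomial s c) := by
    intro s c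
    rw [show Φ (monomial s c) = algebraMap k _ c *
      s.prod fun i e => (Polynomial.C (X i) * Polynomial.X) ^ e from aeval_monomial _ s c,
      ← Polynomial.C_mul_X_pow_eq_monomial, monomial_eq]
    simp only [mul_pow, Finsupp.prod, map_mul, map_prod, map_pow, Finset.prod_mul_distrib,
      Finset.prod_pow_eq_pow_sum, Finsupp.degree_apply, mul_assoc]
    congr 1
  have hco : ∀ (p : MvPolynomial σ k) i, (Φ p).coeff i = homogeneousComponent i p := by
    intro p i
    induction p using MvPolynomial.induction_on' with
    | monomial s c =>
      rw [hmon, Polynomial.coeff_monomial,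
        homogeneousComponent_of_mem (isHomogeneous_monomial c rfl)]
      simp only [eq_comm]
    | add p q hp hq => simp [hp, hq]
  have hne : ∀ p, p ≠ 0 → Φ p ≠ 0 := by
    intro p hp h
    apply hp
    rw [← sum_homogeneousComponent p]
    exact Finset.sum_eq_zero fun i _ => by rw [← hco, h, Polynomial.coeff_zero]
  have hfg : Φ f * Φ g = Polynomial.monomial n (f * g) := by
    rw [← map_mul]
    ext1 i
    rw [hco, homogeneousComponent_of_mem h, Polynomial.coeff_monomial]
    simp only [eq_comm]
  have h1 := Polynomial.natDegree_mul (hne f hf) (hne g hg)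
  have h2 := Polynomial.natTrailingDegree_mul (hne f hf) (hne g hg)
  rw [hfg, Polynomial.natDegree_monomial_eq _ h0] at h1
  rw [hfg, Polynomial.natTrailingDegree_monomial h0] at h2
  have h3 := Polynomial.natTrailingDegree_le_natDegree (Φ f)
  have h4 := Polynomial.natTrailingDegree_le_natDegree (Φ g)
  obtain ⟨m, hm⟩ : ∃ m, f = homogeneousComponent m f := by
    refine ⟨(Φ f).natDegree, ?_⟩
    have hz : ∀ i, i ≠ (Φ f).natDegree → homogeneousComponent i f = 0 := by
      intro i hi
      rw [← hco]
      rcases lt_or_gt_of_ne hi with h | h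
      · exact Polynomial.coeff_eq_zero_of_lt_natTrailingDegree (by omega)
      · exact Polynomial.coeff_eq_zero_of_natDegree_lt h
    conv_lhs => rw [← sum_homogeneousComponent f]
    refine Finset.sum_eq_single _ (fun i _ hi => hz i hi) fun h => ?_
    exact homogeneousComponent_eq_zero _ _ (by simpa using h)
  refine ⟨m, ?_⟩
  rw [hm]
  exact homogeneousComponent_isHomogeneous m f

theorem MvPolynomial.IsHomogeneous.of_dvd {f g : MvPolynomial σ k} {n : ℕ} (hg : g.IsHomogeneous n)
    (h0 : g ≠ 0) (h : f ∣ g) : ∃ m, f.IsHomogeneous m := by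
  obtain ⟨c, rfl⟩ := h
  exact IsHomogeneous.of_mul_left hg h0

theorem MvPolynomial.IsHomogeneous.isUnit_of_zero {f : MvPolynomial σ k} (h : f.IsHomogeneous 0)
    (h0 : f ≠ 0) : IsUnit f := by
  rw [← totalDegree_zero_iff_isHomogeneous, totalDegree_eq_zero_iff_eq_C] at h
  rw [h] at h0 ⊢
  exact (isUnit_iff_ne_zero.2 fun h1 => h0 (by rw [h1, C_0])).map C

theorem MvPolynomial.IsHomogeneous.dvd_homogeneousComponent {p f : MvPolynomial σ k} {m : ℕ}
    (hp : p.IsHomogeneous m) (h : p ∣ f) (i : ℕ) : p ∣ homogeneousComponent i f := by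
  let := MvPolynomial.gradedAlgebra (σ := σ) (R := k)
  rw [← Ideal.mem_span_singleton] at h ⊢
  refine homogeneousComponent_mem_of_mem ?_ h i
  refine Ideal.homogeneous_span _ _ ?_
  rintro _ rfl
  exact ⟨m, hp⟩

theorem MvPolynomial.homogeneousComponent_aeval {τ : Type*} {G : σ → MvPolynomial τ k} {d : ℕ}
    (hd : d ≠ 0) (hG : ∀ i, (G i).IsHomogeneous d) (r : MvPolynomial σ k) (i : ℕ) :
    homogeneousComponent (d * i) (aeval G r) = aeval G (homogeneousComponent i r) := by
  conv_lhs => rw [← sum_homogeneousComponent r]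
  have h : ∀ j, homogeneousComponent (d * i) (aeval G (homogeneousComponent j r)) =
      if i = j then aeval G (homogeneousComponent j r) else 0 := by
    intro j
    rw [homogeneousComponent_of_mem
      ((homogeneousComponent_isHomogeneous j r).aeval G hG)]
    simp [hd]
  simp only [map_sum, h]
  rw [Finset.sum_ite_eq]
  split_ifs with h1
  · rfl
  · rw [homogeneousComponent_eq_zero _ _ (by simpa using h1), map_zero]

/-- A nonzero homogeneous polynomial of characteristic zero and positive degree does not divide all
its partial derivatives. -/
theorem exists_not_dvd_pderiv [Fintype σ] [CharZero k] {r : MvPolynomial σ k} {m : ℕ}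
    (hr : r.IsHomogeneous m) (h0 : r ≠ 0) (hu : ¬ IsUnit r) : ∃ i, ¬ r ∣ pderiv i r := by
  by_contra! h
  have hm : m ≠ 0 := by
    rintro rfl
    exact hu (IsHomogeneous.isUnit_of_zero hr h0)
  have hz : ∀ i, pderiv i r = 0 := by
    intro i
    by_contra hi
    obtain ⟨c, hc⟩ := h i
    have h1 := (hr.pderiv (i := i)).totalDegree hi
    have h2 := hr.totalDegree h0
    rw [hc] at hi h1
    rw [totalDegree_mul_of_isDomain h0 (right_ne_zero_of_mul hi), h2] at h1
    omega
  have h3 := hr.sum_X_mul_pderiv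
  simp only [hz, mul_zero, Finset.sum_const_zero] at h3
  exact (smul_ne_zero hm h0) h3.symm

/-- Induction on the degree of a relation `r(G) = 0`: the chain rule and the nonzero determinant
make each `∂ᵢr` a relation of lower degree, hence zero, and Euler's identity kills `r`. -/
theorem aeval_injective_of_det_ne_zero [Fintype σ] [DecidableEq σ] [CharZero k]
    {G : σ → MvPolynomial σ k}
    {d : ℕ} (hd : d ≠ 0) (hG : ∀ i, (G i).IsHomogeneous d) (hdet : (jacobianMatrix G).det ≠ 0) :
    Function.Injective (aeval G : MvPolynomial σ k →ₐ[k] MvPolynomial σ k) := by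
  have key : ∀ (m : ℕ) (r : MvPolynomial σ k), r.IsHomogeneous m → aeval G r = 0 → r = 0 := by
    intro m
    induction m with
    | zero =>
      intro r hr h
      by_contra h0
      exact ((IsHomogeneous.isUnit_of_zero hr h0).map (aeval G)).ne_zero h
    | succ m ih =>
      intro r hr h
      have hz : ∀ i, aeval G (pderiv i r) = 0 := by
        refine congrFun (Matrix.eq_zero_of_vecMul_eq_zero hdet ?_)
        ext1 j
        have h1 := (pderiv j).aeval_eq_sum_pderiv G r
        rw [h, map_zero] at h1
        exact h1.symm
      have h3 := hr.sum_X_mul_pderiv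
      simp only [fun i => ih _ (hr.pderiv (i := i)) (hz i), mul_zero, Finset.sum_const_zero] at h3
      exact ((smul_eq_zero.1 h3.symm).resolve_left m.succ_ne_zero)
  rw [injective_iff_map_eq_zero]
  intro r hr
  rw [← sum_homogeneousComponent r]
  refine Finset.sum_eq_zero fun i _ => key i _ (homogeneousComponent_isHomogeneous i r) ?_
  rw [← homogeneousComponent_aeval hd hG, hr, map_zero]

/-- By the Nullstellensatz a power of each variable lies in the ideal `(G)`. A graded Nakayama
argument then shows that finitely many monomials span `k[X]` over `k[G]`. -/
theorem aeval_isIntegral [Fintype σ] [IsAlgClosed k] {G : σ → MvPolynomial σ k} {d : ℕ}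
    (hd : d ≠ 0) (hG : ∀ i, (G i).IsHomogeneous d)
    (hzero : ∀ x, (∀ i, eval x (G i) = 0) → x = 0) :
    (aeval G : MvPolynomial σ k →ₐ[k] MvPolynomial σ k).toRingHom.IsIntegral := by
  classical
  set φ : MvPolynomial σ k →ₐ[k] MvPolynomial σ k := aeval G
  let I : Ideal (MvPolynomial σ k) := Ideal.span (Set.range G)
  have hrad : ∀ i, X i ∈ I.radical := by
    intro i
    rw [← vanishingIdeal_zeroLocus_eq_radical (K := k), mem_vanishingIdeal_iff]
    intro x hx
    have : x = 0 := hzero x fun j => by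
      simpa [aeval_eq_eval] using hx (G j) (Ideal.subset_span ⟨j, rfl⟩)
    simp [this]
  choose N hN using hrad
  let N' : σ →₀ ℕ := Finsupp.equivFunOnFinite.symm N
  let M : Submodule φ.range (MvPolynomial σ k) :=
    Submodule.span φ.range ((fun s => monomial s (1 : k)) '' Set.Iic N')
  have hmem : ∀ m, ∀ f : MvPolynomial σ k, f.IsHomogeneous m → f ∈ M := by
    intro m
    induction m using Nat.strong_induction_on with
    | _ m ih =>
    -- The coefficients of the `G i` can be taken of degree `m - d < m`, and the `G i` act as
    -- scalars.
    have hI : ∀ g ∈ I, g.IsHomogeneous m → g ∈ M := by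
      intro g hg hgm
      obtain ⟨c, rfl⟩ := Ideal.mem_span_range_iff_exists_fun.1 hg
      rw [← homogeneousComponent_eq_self hgm, map_sum]
      refine Submodule.sum_mem _ fun i _ => ?_
      rw [← sum_homogeneousComponent (c i), Finset.sum_mul, map_sum]
      refine Submodule.sum_mem _ fun j _ => ?_
      rw [homogeneousComponent_of_mem ((homogeneousComponent_isHomogeneous j (c i)).mul (hG i))]
      split_ifs with hj
      · have h1 := M.smul_mem (⟨φ (X i), X i, rfl⟩ : φ.range)
          (ih j (by omega) _ (homogeneousComponent_isHomogeneous j (c i)))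
        have h2 : φ (X i) = G i := aeval_X G i
        rw [Subalgebra.smul_def, smul_eq_mul, mul_comm] at h1
        exact h2 ▸ h1
      · exact M.zero_mem
    intro f hf
    rw [f.as_sum]
    refine Submodule.sum_mem _ fun s hs => ?_
    have hsm : s.degree = m := by
      by_contra h
      exact (mem_support_iff.1 hs) (hf.coeff_eq_zero h)
    have hmon : monomial s (1 : k) ∈ M := by
      by_cases hsN : s ≤ N'
      · exact Submodule.subset_span ⟨s, hsN, rfl⟩
      · refine hI _ ?_ (isHomogeneous_monomial _ hsm)
        rw [Finsupp.le_def] at hsN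
        push Not at hsN
        obtain ⟨i, hi⟩ := hsN
        refine I.mem_of_dvd ?_ (hN i)
        rw [X_pow_eq_monomial, monomial_dvd_monomial]
        refine ⟨Or.inr ?_, one_dvd _⟩
        rw [Finsupp.single_le_iff]
        exact hi.le
    have h2 := M.smul_mem (algebraMap k φ.range (coeff s f)) hmon
    rwa [algebraMap_smul, smul_monomial, smul_eq_mul, mul_one] at h2
  have htop : M = ⊤ := by
    refine eq_top_iff.2 fun f _ => ?_
    rw [← sum_homogeneousComponent f]
    exact Submodule.sum_mem _ fun i _ => hmem i _ (homogeneousComponent_isHomogeneous i f)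
  have hfin : Module.Finite φ.range (MvPolynomial σ k) :=
    ⟨htop ▸ Submodule.fg_span ((Set.finite_Iic N').image _)⟩
  have h1 : (algebraMap φ.range (MvPolynomial σ k)).IsIntegral :=
    algebraMap_isIntegral_iff.2 inferInstance
  exact RingHom.IsIntegral.trans φ.rangeRestrict.toRingHom (algebraMap φ.range _)
    (RingHom.isIntegral_of_surjective _ φ.rangeRestrict_surjective) h1

end

/-! ### Images of prime divisors and the reduced equation. -/

/-- The contraction of `(p)` is nonzero, so it contains a prime `r`. Were it larger than `(r)`,
going down would give a nonzero prime strictly inside `(p)`; a prime element of it would be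
associated to `p`, a contradiction. -/
theorem exists_prime_comap_span_singleton {A B : Type*} [CommRing A] [IsDomain A]
    [UniqueFactorizationMonoid A] [CommRing B] [IsDomain B] [UniqueFactorizationMonoid B]
    (φ : B →+* A) (hφ : φ.IsIntegral) (hinj : Function.Injective φ) {p : A} (hp : Prime p) :
    ∃ r : B, Prime r ∧ ∀ b, p ∣ φ b ↔ r ∣ b := by
  let := φ.toAlgebra
  have : Algebra.IsIntegral B A := ⟨hφ⟩
  have : FaithfulSMul B A := (faithfulSMul_iff_algebraMap_injective B A).2 hinj
  let Q := Ideal.span {p}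
  have hQ : Q.IsPrime := (Ideal.span_singleton_prime hp.ne_zero).2 hp
  have hne : Q.under B ≠ ⊥ := Ideal.comap_ne_bot_of_algebraic_mem hp.ne_zero
    (Ideal.mem_span_singleton_self p) (Algebra.IsIntegral.isIntegral p).isAlgebraic
  obtain ⟨r, hr, hrp⟩ := Ideal.IsPrime.exists_mem_prime_of_ne_bot
    (inferInstance : (Q.under B).IsPrime) hne
  refine ⟨r, hrp, ?_⟩
  have hle : Ideal.span {r} ≤ Q.under B := (Ideal.span_singleton_le_iff_mem _).2 hr
  have hrI : (Ideal.span {r}).IsPrime := (Ideal.span_singleton_prime hrp.ne_zero).2 hrp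
  have heq : Ideal.span {r} = Q.under B := by
    refine eq_of_le_of_not_lt hle fun hlt => ?_
    obtain ⟨P, hPQ, hP, hPr⟩ := Ideal.exists_ideal_lt_liesOver_of_lt Q hlt
    have hP0 : P ≠ ⊥ := by
      rintro rfl
      have h1 := hPr.over
      have h2 : r ∈ (⊥ : Ideal A).under B := h1 ▸ Ideal.mem_span_singleton_self r
      rw [Ideal.mem_comap, Ideal.mem_bot] at h2
      exact hrp.ne_zero (hinj (h2.trans (map_zero _).symm))
    obtain ⟨q, hq, hqp⟩ := Ideal.IsPrime.exists_mem_prime_of_ne_bot hP hP0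
    have h3 : p ∣ q := Ideal.mem_span_singleton.1 (hPQ.le hq)
    have h4 := hp.associated_of_dvd hqp h3
    refine hPQ.not_ge ((Ideal.span_singleton_le_iff_mem _).2 (P.mem_of_dvd h4.symm.dvd hq))
  intro b
  rw [← Ideal.mem_span_singleton (x := b), heq, Ideal.mem_comap, Ideal.mem_span_singleton]
  rfl

theorem mul_radical_dvd {A : Type*} [CommMonoidWithZero A]
    [UniqueFactorizationMonoid A] [NormalizationMonoid A] {J H : A}
    (h : ∀ p, Prime p → ∀ e, p ∣ J → p ^ e ∣ J → p ^ (e + 1) ∣ H) (hJ : J ≠ 0) :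
    J * UniqueFactorizationMonoid.radical J ∣ H := by
  induction J using UniqueFactorizationMonoid.induction_on_coprime with
  | h0 => exact absurd rfl hJ
  | h1 hu => 
    rw [UniqueFactorizationMonoid.radical_of_isUnit hu, mul_one]
    exact hu.dvd
  | hpr i hp =>
    obtain _ | i := i
    · simp
    · rw [UniqueFactorizationMonoid.radical_pow_of_prime hp i.succ_ne_zero]
      rw [(normalize_associated _).mul_left _ |>.dvd_iff_dvd_left, ← pow_succ]
      exact h _ hp _ (dvd_pow_self _ i.succ_ne_zero) dvd_rfl
  | hcp hxy hx hy =>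
    rw [UniqueFactorizationMonoid.radical_mul hxy, mul_mul_mul_comm]
    have h1 := hx (fun p hp e h1 h2 => h p hp e (h1.mul_right _) (h2.mul_right _))
      (left_ne_zero_of_mul hJ)
    have h2 := hy (fun p hp e h1 h2 => h p hp e (h1.mul_left _) (h2.mul_left _))
      (right_ne_zero_of_mul hJ)
    -- `x * radical x` divides `x * x`, so coprimality of the squares suffices.
    have hxy2 := (hxy.mul_left hxy).mul_right (hxy.mul_left hxy)
    refine IsRelPrime.mul_dvd (fun d hd1 hd2 => hxy2
      (hd1.trans (mul_dvd_mul_left _ UniqueFactorizationMonoid.radical_dvd_self))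
      (hd2.trans (mul_dvd_mul_left _ UniqueFactorizationMonoid.radical_dvd_self))) h1 h2

theorem exists_isMaximal_comap_eq {A B : Type*} [CommRing A] [CommRing B] (φ : B →+* A)
    (hφ : φ.IsIntegral) (P : Ideal B) [hP : P.IsMaximal] (I : Ideal A) [I.IsPrime]
    (h : I.comap φ ≤ P) : ∃ Q ≥ I, Q.IsMaximal ∧ Q.comap φ = P := by
  let := φ.toAlgebra
  have : Algebra.IsIntegral B A := ⟨hφ⟩
  obtain ⟨Q, hIQ, hQ, hQP⟩ := Ideal.exists_ideal_over_prime_of_isIntegral_of_isPrime P I h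
  exact ⟨Q, hIQ, Ideal.isMaximal_of_isIntegral_of_isMaximal_comap (R := B) Q (hQP ▸ hP), hQP⟩

section

variable {σ k : Type*} [Field k]

theorem eval_aeval_eq {τ : Type*} (G : σ → MvPolynomial τ k) (r : MvPolynomial σ k) (x : τ → k) :
    eval x (aeval G r) = eval (fun i => eval x (G i)) r := by
  induction r using MvPolynomial.induction_on with
  | C a => simp [algebraMap_eq]
  | add p q hp hq => rw [map_add, map_add, map_add, hp, hq]
  | mul_X p i hp => rw [map_mul, map_mul, map_mul, hp, aeval_X, eval_X]

theorem eval_eq_zero_of_dvd {p q : MvPolynomial σ k} (h : p ∣ q) {x : σ → k}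
    (hx : eval x p = 0) : eval x q = 0 := by
  obtain ⟨c, rfl⟩ := h
  rw [map_mul, hx, zero_mul]

/-- Lying over, applied to the maximal ideal of `y`: the map from `{p = 0}` to `{r = 0}` is onto. -/
theorem exists_eval_eq_zero_of_dvd_aeval [Finite σ] [IsAlgClosed k] {G : σ → MvPolynomial σ k}
    (hG : (aeval G : MvPolynomial σ k →ₐ[k] MvPolynomial σ k).toRingHom.IsIntegral)
    {p r : MvPolynomial σ k} (hp : Prime p) (hpr : ∀ b, p ∣ aeval G b ↔ r ∣ b) {y : σ → k}
    (hy : eval y r = 0) : ∃ x, eval x p = 0 ∧ ∀ i, eval x (G i) = y i := by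
  have hprime : (Ideal.span {p}).IsPrime := (Ideal.span_singleton_prime hp.ne_zero).2 hp
  have hmax : (vanishingIdeal k {y} : Ideal (MvPolynomial σ k)).IsMaximal :=
    isMaximal_iff_eq_vanishingIdeal_singleton.2 ⟨y, rfl⟩
  obtain ⟨Q, hpQ, hQ, hQy⟩ := exists_isMaximal_comap_eq _ hG (vanishingIdeal k {y})
    (Ideal.span {p}) (by
      intro b hb
      rw [mem_vanishingIdeal_singleton_iff, aeval_eq_eval]
      exact eval_eq_zero_of_dvd ((hpr b).1 (Ideal.mem_span_singleton.1 hb)) hy)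
  obtain ⟨x, rfl⟩ := isMaximal_iff_eq_vanishingIdeal_singleton.1 hQ
  have h1 : ∀ b ∈ (vanishingIdeal k {x} : Ideal (MvPolynomial σ k)), eval x b = 0 := by
    intro b hb
    rwa [mem_vanishingIdeal_singleton_iff, aeval_eq_eval] at hb
  refine ⟨x, h1 p (hpQ (Ideal.mem_span_singleton_self p)), fun i => ?_⟩
  have h2 : X i - C (y i) ∈ (vanishingIdeal k {y} : Ideal (MvPolynomial σ k)) := by
    simp
  rw [← hQy, Ideal.mem_comap] at h2
  have h3 := h1 _ h2
  have h4 : (aeval G : MvPolynomial σ k →ₐ[k] MvPolynomial σ k).toRingHom (X i - C (y i)) =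
      G i - C (y i) := by
    simp [algebraMap_eq]
  rw [h4, map_sub, eval_C] at h3
  exact sub_eq_zero.1 h3

/-- Since `p` divides every component of `r ∘ G`, `r` divides its own components, and a divisor of a
nonzero homogeneous polynomial is homogeneous. -/
theorem exists_prime_isHomogeneous_comap [Finite σ] {G : σ → MvPolynomial σ k} {d : ℕ}
    (hd : d ≠ 0) (hGd : ∀ i, (G i).IsHomogeneous d)
    (hG : (aeval G : MvPolynomial σ k →ₐ[k] MvPolynomial σ k).toRingHom.IsIntegral)
    (hinj : Function.Injective (aeval G : MvPolynomial σ k →ₐ[k] MvPolynomial σ k))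
    {p : MvPolynomial σ k} (hp : Prime p) {m : ℕ} (hpm : p.IsHomogeneous m) :
    ∃ r : MvPolynomial σ k, Prime r ∧ (∃ l, r.IsHomogeneous l) ∧
      ∀ b, p ∣ aeval G b ↔ r ∣ b := by
  obtain ⟨r, hr, h⟩ := exists_prime_comap_span_singleton _ hG hinj hp
  refine ⟨r, hr, ?_, h⟩
  obtain ⟨i, hi⟩ : ∃ i, homogeneousComponent i r ≠ 0 := by
    by_contra! h0
    apply hr.ne_zero
    rw [← sum_homogeneousComponent r]
    exact Finset.sum_eq_zero fun i _ => h0 i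
  refine IsHomogeneous.of_dvd (homogeneousComponent_isHomogeneous i r) hi ((h _).1 ?_)
  change p ∣ aeval G _
  rw [← homogeneousComponent_aeval hd hGd]
  exact IsHomogeneous.dvd_homogeneousComponent hpm ((h r).2 dvd_rfl) _

variable [Fintype σ] [DecidableEq σ] [CharZero k] [IsAlgClosed k]

/-- The image of the hypersurface `J = 0` under a finite homogeneous map `G` has a reduced equation
`R`, and if `J` divides the Jacobian determinant of `G` then the pull-back of `R` vanishes along
every component of `J = 0` to a higher order than `J`. -/
theorem exists_reduced_equation_image {G : σ → MvPolynomial σ k} {d : ℕ} (hd : d ≠ 0)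
    (hGd : ∀ i, (G i).IsHomogeneous d) (hzero : ∀ x, (∀ i, eval x (G i) = 0) → x = 0)
    {J : MvPolynomial σ k} {m : ℕ} (hJm : J.IsHomogeneous m)
    (hJ : J ∣ (jacobianMatrix G).det) :
    ∃ R : MvPolynomial σ k, (∃ l, R.IsHomogeneous l) ∧ Squarefree R ∧
      (∀ y, eval y R = 0 ↔ ∃ x, eval x J = 0 ∧ ∀ i, eval x (G i) = y i) ∧
      ∃ T, J * T ∣ aeval G R ∧ ∀ x, eval x J = 0 → eval x T = 0 := by
  have hint := aeval_isIntegral hd hGd hzero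
  have hdet := det_jacobianMatrix_ne_zero G hint
  have hinj := aeval_injective_of_det_ne_zero hd hGd hdet
  have hJ0 : J ≠ 0 := ne_zero_of_dvd_ne_zero hdet hJ
  let : StrongNormalizationMonoid (MvPolynomial σ k) :=
    UniqueFactorizationMonoid.strongNormalizationMonoid
  let S := UniqueFactorizationMonoid.primeFactors J
  have hS : ∀ q ∈ S, Prime q ∧ q ∣ J := fun q hq =>
    have h := UniqueFactorizationMonoid.mem_primeFactors.1 hq
    ⟨UniqueFactorizationMonoid.prime_of_normalized_factor q h,
      UniqueFactorizationMonoid.dvd_of_mem_normalizedFactors h⟩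
  have hex : ∀ q, ∃ r : MvPolynomial σ k, q ∈ S → Prime r ∧ (∃ l, r.IsHomogeneous l) ∧
      ∀ b, q ∣ aeval G b ↔ r ∣ b := by
    intro q
    by_cases hq : q ∈ S
    · obtain ⟨m', hm'⟩ := IsHomogeneous.of_dvd hJm hJ0 (hS q hq).2
      obtain ⟨r, hr⟩ := exists_prime_isHomogeneous_comap hd hGd hint hinj (hS q hq).1 hm'
      exact ⟨r, fun _ => hr⟩
    · exact ⟨0, fun h => absurd h hq⟩
  choose r hr using hex
  -- Distinct components of `J = 0` may have the same image, so the radical of `N` is taken.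
  let N := ∏ q ∈ S, r q
  have hN0 : N ≠ 0 := Finset.prod_ne_zero_iff.2 fun q hq => (hr q hq).1.ne_zero
  have hrN : ∀ q ∈ S, r q ∣ UniqueFactorizationMonoid.radical N := by
    intro q hq
    obtain ⟨l, hl⟩ := UniqueFactorizationMonoid.exists_dvd_radical_self_pow hN0
    exact (hr q hq).1.dvd_of_dvd_pow ((Finset.dvd_prod_of_mem r hq).trans hl)
  have hradN : ∀ y, eval y (UniqueFactorizationMonoid.radical N) = 0 ↔
      ∃ q ∈ S, eval y (r q) = 0 := by
    intro y
    constructor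
    · intro h
      have h1 := eval_eq_zero_of_dvd UniqueFactorizationMonoid.radical_dvd_self h
      rwa [map_prod, Finset.prod_eq_zero_iff] at h1
    · rintro ⟨q, hq, h⟩
      exact eval_eq_zero_of_dvd (hrN q hq) h
  have hradJ : ∀ x, eval x J = 0 → eval x (UniqueFactorizationMonoid.radical J) = 0 := by
    intro x hx
    obtain ⟨l, hl⟩ := UniqueFactorizationMonoid.exists_dvd_radical_self_pow hJ0
    have h := eval_eq_zero_of_dvd hl hx
    rw [map_pow] at h
    exact eq_zero_of_pow_eq_zero h
  refine ⟨UniqueFactorizationMonoid.radical N, ?_, UniqueFactorizationMonoid.squarefree_radical,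
    ?_, UniqueFactorizationMonoid.radical J, ?_, hradJ⟩
  · choose! l hl using fun q hq => (hr q hq).2.1
    exact IsHomogeneous.of_dvd (MvPolynomial.IsHomogeneous.prod S r l hl) hN0
      UniqueFactorizationMonoid.radical_dvd_self
  · intro y
    rw [hradN]
    constructor
    · rintro ⟨q, hq, hy⟩
      obtain ⟨x, hx, hxy⟩ := exists_eval_eq_zero_of_dvd_aeval hint (hS q hq).1 (hr q hq).2.2 hy
      exact ⟨x, eval_eq_zero_of_dvd (hS q hq).2 hx, hxy⟩
    · rintro ⟨x, hx, hxy⟩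
      have h1 := hradJ x hx
      rw [UniqueFactorizationMonoid.radical, map_prod, Finset.prod_eq_zero_iff] at h1
      obtain ⟨q, hq, h2⟩ := h1
      refine ⟨q, hq, ?_⟩
      have h3 := eval_eq_zero_of_dvd (((hr q hq).2.2 _).2 dvd_rfl) h2
      rwa [eval_aeval_eq, funext hxy] at h3
  · refine mul_radical_dvd (fun p hp e hpJ hpe => ?_) hJ0
    obtain ⟨q, hq, hpq⟩ := UniqueFactorizationMonoid.exists_mem_normalizedFactors_of_dvd hJ0
      hp.irreducible hpJ
    replace hq : q ∈ S := UniqueFactorizationMonoid.mem_primeFactors.2 hq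
    obtain ⟨hrp, ⟨l, hl⟩, hqr⟩ := hr q hq
    obtain ⟨i, hi⟩ := exists_not_dvd_pderiv hl hrp.ne_zero hrp.not_isUnit
    have h1 := pow_succ_dvd_aeval_of_pow_dvd_det G hint (hS q hq).1 ((hqr _).2 dvd_rfl)
      (by rw [Ne, map_eq_zero_iff _ hinj]; exact hrp.ne_zero) (mt (hqr _).1 hi)
      (((hpq.pow_pow (n := e)).symm.dvd.trans hpe).trans hJ)
    exact (hpq.pow_pow.dvd.trans h1).trans (map_dvd (aeval G) (hrN q hq))

end

/-! ### Zeros in projective space, local lifts and orders. -/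

theorem eval_smul_of_isHomogeneous {σ k : Type*} [Field k] {P : MvPolynomial σ k} {m : ℕ}
    (hP : P.IsHomogeneous m) (a : k) (x : σ → k) : eval (a • x) P = a ^ m * eval x P := by
  rw [eval_eq, eval_eq, Finset.mul_sum]
  refine Finset.sum_congr rfl fun s hs => ?_
  have h : ∑ i ∈ s.support, s i = m := by
    by_contra h
    exact (mem_support_iff.1 hs) (hP.coeff_eq_zero h)
  simp only [Pi.smul_apply, smul_eq_mul, mul_pow, Finset.prod_mul_distrib,
    Finset.prod_pow_eq_pow_sum, h]
  ring

/-- A nonzero homogeneous polynomial of positive degree in at least two variables over an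
algebraically closed field has a nontrivial zero. -/
theorem exists_ne_zero_eval_eq_zero {σ k : Type*} [Finite σ] [Nontrivial σ] [Field k]
    [IsAlgClosed k] {P : MvPolynomial σ k} {m : ℕ} (hP : P.IsHomogeneous m) (hm : m ≠ 0)
    (h0 : P ≠ 0) : ∃ x ≠ 0, eval x P = 0 := by
  by_contra! h
  -- Without nontrivial zeros `P` divides a power of each variable, so an irreducible factor would
  -- be associated to two distinct variables.
  have hX : ∀ i, ∃ N, P ∣ X i ^ N := by
    intro i
    have h1 : X i ∈ (Ideal.span {P}).radical := by
      rw [← vanishingIdeal_zeroLocus_eq_radical (K := k), mem_vanishingIdeal_iff]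
      intro x hx
      by_contra hxi
      refine h x (by rintro rfl; simp at hxi) ?_
      simpa [aeval_eq_eval] using hx P (Ideal.mem_span_singleton_self P)
    obtain ⟨N, hN⟩ := h1
    exact ⟨N, Ideal.mem_span_singleton.1 hN⟩
  have hu : ¬ IsUnit P := by
    intro hu
    have h1 := hP.totalDegree h0
    rw [(isUnit_iff_totalDegree_of_isReduced.1 hu).2] at h1
    exact hm h1.symm
  obtain ⟨q, hq, hqP⟩ := WfDvdMonoid.exists_irreducible_factor hu h0
  obtain ⟨i, j, hij⟩ := exists_pair_ne σ
  have hass : ∀ i, q ∣ X i := fun i =>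
    (UniqueFactorizationMonoid.irreducible_iff_prime.1 hq).dvd_of_dvd_pow
      (hqP.trans (hX i).choose_spec)
  have hXp : ∀ i, Irreducible (X i : MvPolynomial σ k) := fun i => X_prime.irreducible
  have h1 : (X i : MvPolynomial σ k) ∣ X j :=
    ((hq.associated_of_dvd (hXp i) (hass i)).symm.dvd).trans (hass j)
  rw [X_dvd_X] at h1
  exact hij h1

theorem isHomogeneous_det {σ τ R : Type*} [Fintype τ] [DecidableEq τ] [CommRing R]
    {A : Matrix τ τ (MvPolynomial σ R)} {e : τ → ℕ} (h : ∀ i j, (A i j).IsHomogeneous (e i)) :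
    A.det.IsHomogeneous (∑ i, e i) := by
  rw [Matrix.det_apply']
  refine MvPolynomial.IsHomogeneous.sum _ _ _ fun s _ => ?_
  rw [← Equiv.sum_comp s e, ← zero_add (∑ i, e (s i))]
  refine MvPolynomial.IsHomogeneous.mul ?_ (MvPolynomial.IsHomogeneous.prod _ _ _ fun i _ => h _ _)
  rw [← map_intCast (C : R →+* MvPolynomial σ R)]
  exact isHomogeneous_C _ _

theorem mk_mem_projZeros {n m : ℕ} {P : CoordPoly n} (hP : P.IsHomogeneous m)
    {x : Fin (n + 1) → ℂ} (hx : x ≠ 0) :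
    Projectivization.mk ℂ x hx ∈ projZeros P ↔ eval x P = 0 := by
  obtain ⟨a, ha⟩ := Projectivization.exists_smul_eq_mk_rep ℂ x hx
  change eval (Projectivization.mk ℂ x hx).rep P = 0 ↔ _
  rw [← ha, Units.smul_def, eval_smul_of_isHomogeneous hP, mul_eq_zero, or_iff_right]
  exact pow_ne_zero _ a.ne_zero

section

variable {n : ℕ} {d : Fin (n + 1) → ℕ} {Q : Fin (n + 1) → CoordPoly n}

/-- The homogeneous coordinates `Qᵢ^{mᵢ}` of the endomorphism `F`. -/
noncomputable def endoPoly (d : Fin (n + 1) → ℕ) (Q : Fin (n + 1) → CoordPoly n)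
    (i : Fin (n + 1)) : CoordPoly n :=
  Q i ^ lcmExponent d i

theorem eval_endoPoly (x : Fin (n + 1) → ℂ) : (fun i => eval x (endoPoly d Q i)) = endoVec d Q x := by
  ext i
  simp [endoPoly, endoVec]

theorem endoPoly_isHomogeneous (hQ : ∀ i, (Q i).IsHomogeneous (d i)) (i : Fin (n + 1)) :
    (endoPoly d Q i).IsHomogeneous (Finset.univ.lcm d) := by
  have h := (hQ i).pow (lcmExponent d i)
  rwa [lcmExponent, Nat.mul_div_cancel' (Finset.dvd_lcm (Finset.mem_univ i))] at h

theorem endoVec_smul (hQ : ∀ i, (Q i).IsHomogeneous (d i)) (a : ℂ) (x : Fin (n + 1) → ℂ) :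
    endoVec d Q (a • x) = a ^ Finset.univ.lcm d • endoVec d Q x := by
  ext i
  simp only [← eval_endoPoly, eval_smul_of_isHomogeneous (endoPoly_isHomogeneous hQ i),
    Pi.smul_apply, smul_eq_mul]

theorem projEndo_mk (hQ : ∀ i, (Q i).IsHomogeneous (d i))
    (h : InGeneralPosition fun o => projZeros (withJacobian Q o)) {x : Fin (n + 1) → ℂ}
    (hx : x ≠ 0) : ∃ hx' : endoVec d Q x ≠ 0,
      projEndo d Q h (Projectivization.mk ℂ x hx) = Projectivization.mk ℂ (endoVec d Q x) hx' := by
  obtain ⟨a, ha⟩ := Projectivization.exists_smul_eq_mk_rep ℂ x hx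
  have h1 := endoVec_ne_zero d Q h (Projectivization.mk ℂ x hx)
  have h2 : endoVec d Q (Projectivization.mk ℂ x hx).rep =
      (a : ℂ) ^ Finset.univ.lcm d • endoVec d Q x := by
    rw [← ha, Units.smul_def, endoVec_smul hQ]
  refine ⟨fun h0 => h1 (by rw [h2, h0, smul_zero]), ?_⟩
  rw [projEndo, Projectivization.mk_eq_mk_iff']
  exact ⟨_, h2.symm⟩

/-- Row `i` of `DG` is `m i * Q i ^ (m i - 1)` times row `i` of `DQ`. -/
theorem jacobianPoly_dvd_det : jacobianPoly Q ∣ (jacobianMatrix (endoPoly d Q)).det := by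
  have h : jacobianMatrix (endoPoly d Q) = Matrix.of fun i j =>
      (lcmExponent d i * Q i ^ (lcmExponent d i - 1)) *
        (Matrix.of fun i j => pderiv j (Q i) : Matrix _ _ (CoordPoly n)) i j := by
    ext1 i j
    simp only [jacobianMatrix, endoPoly, Matrix.of_apply, Derivation.leibniz_pow, smul_eq_mul,
      nsmul_eq_mul, mul_assoc]
  rw [h, Matrix.det_mul_column]
  exact dvd_mul_left _ _

theorem jacobianPoly_isHomogeneous (hQ : ∀ i, (Q i).IsHomogeneous (d i)) :
    (jacobianPoly Q).IsHomogeneous (∑ i, (d i - 1)) :=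
  isHomogeneous_det fun i _ => (hQ i).pderiv

/-- Two local lifts of the same curve differ by a holomorphic factor. -/
theorem exists_analyticAt_smul_eq {g : ℂ → CProj n} {z : ℂ} {φ ψ : ℂ → Fin (n + 1) → ℂ}
    (hφ : IsLocalLift g z φ) (hψ : IsLocalLift g z ψ) :
    ∃ c : ℂ → ℂ, AnalyticAt ℂ c z ∧ ∀ᶠ w in 𝓝 z, ψ w = c w • φ w := by
  obtain ⟨hz, -⟩ := hφ.2.self_of_nhds
  obtain ⟨i, hi⟩ := Function.ne_iff.1 hz
  have hφi := analyticAt_pi_iff.1 hφ.1 i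
  refine ⟨fun w => ψ w i / φ w i, (analyticAt_pi_iff.1 hψ.1 i).div hφi hi, ?_⟩
  filter_upwards [hφ.2, hψ.2, hφi.continuousAt.eventually_ne hi] with w h1 h2 h3
  obtain ⟨h1, h1'⟩ := h1
  obtain ⟨h2, h2'⟩ := h2
  rw [h1', Projectivization.mk_eq_mk_iff] at h2'
  obtain ⟨a, ha⟩ := h2'
  rw [Units.smul_def] at ha
  have ha0 := a.ne_zero
  have h4 : ψ w = (a : ℂ)⁻¹ • φ w := by rw [← ha, inv_smul_smul₀ ha0]
  rw [h4, Pi.smul_apply, smul_eq_mul, mul_div_cancel_right₀ _ h3]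

theorem analyticAt_eval {z : ℂ} {φ : ℂ → Fin (n + 1) → ℂ} (hφ : AnalyticAt ℂ φ z)
    (P : CoordPoly n) : AnalyticAt ℂ (fun w => eval (φ w) P) z := by
  simpa [aeval_eq_eval] using AnalyticAt.aeval_mvPolynomial (analyticAt_pi_iff.1 hφ) P

theorem IsLocalLift.projEndo_comp (hQ : ∀ i, (Q i).IsHomogeneous (d i))
    (h : InGeneralPosition fun o => projZeros (withJacobian Q o)) {f : ℂ → CProj n} {z : ℂ}
    {φ : ℂ → Fin (n + 1) → ℂ} (hφ : IsLocalLift f z φ) :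
    IsLocalLift (projEndo d Q h ∘ f) z fun w => endoVec d Q (φ w) := by
  constructor
  · refine analyticAt_pi_iff.2 fun i => ?_
    simp only [← eval_endoPoly]
    exact analyticAt_eval hφ.1 _
  · filter_upwards [hφ.2] with w hw
    obtain ⟨hw, hw'⟩ := hw
    rw [Function.comp_apply, hw']
    exact projEndo_mk hQ h hw

/-- One lift of `f` bounds the left infimum. Any lift of `g` is an analytic multiple of the induced
one, so the cofactors only add order, while `T` contributes at least 1 at `z`. -/
theorem ordPullback_add_one_le (hQ : ∀ i, (Q i).IsHomogeneous (d i))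
    (h : InGeneralPosition fun o => projZeros (withJacobian Q o)) {J R T : CoordPoly n} {m l : ℕ}
    (hJ : J.IsHomogeneous m) (hR : R.IsHomogeneous l) (hT : J * T ∣ aeval (endoPoly d Q) R)
    (hT0 : ∀ x, eval x J = 0 → eval x T = 0) {f : ℂ → CProj n} {z : ℂ}
    (hf : ∃ φ, IsLocalLift f z φ) (hz : f z ∈ projZeros J) :
    ordPullback f J z + 1 ≤ ordPullback (projEndo d Q h ∘ f) R z := by
  obtain ⟨φ, hφ⟩ := hf
  refine le_iInf₂ fun ψ hψ => ?_
  have h1 : ordPullback f J z ≤ analyticOrderAt (fun w => eval (φ w) J) z := iInf₂_le φ hφ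
  refine (add_le_add_left h1 1).trans ?_
  obtain ⟨c, hc, hcψ⟩ := exists_analyticAt_smul_eq (hφ.projEndo_comp hQ h) hψ
  obtain ⟨S, hS⟩ := hT
  have h2 : (fun w => eval (ψ w) R) =ᶠ[𝓝 z] (fun w => eval (φ w) J) * (fun w => eval (φ w) T) *
      ((fun w => eval (φ w) S) * c ^ l) := by
    filter_upwards [hcψ] with w hw
    rw [hw, eval_smul_of_isHomogeneous hR, ← eval_endoPoly, ← eval_aeval_eq, hS]
    simp only [map_mul, Pi.mul_apply, Pi.pow_apply]
    ring
  have hJa := analyticAt_eval hφ.1 J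
  have hTa := analyticAt_eval hφ.1 T
  have hSa := analyticAt_eval hφ.1 S
  rw [analyticOrderAt_congr h2, analyticOrderAt_mul (hJa.mul hTa) (hSa.mul (hc.pow l)),
    analyticOrderAt_mul hJa hTa]
  refine le_add_right (add_le_add_right ?_ _)
  obtain ⟨hφz, hfz⟩ := hφ.2.self_of_nhds
  rw [hfz, mk_mem_projZeros hJ] at hz
  rw [Order.one_le_iff_ne_zero, hTa.analyticOrderAt_ne_zero]
  exact hT0 _ hz

end

theorem mainTheorem6 (n : ℕ) (hn : 1 ≤ n)
    (d : Fin (n + 1) → ℕ) (hd : ∀ i, 1 ≤ d i) (hdeg : n + 2 ≤ ∑ i, d i)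
    (Q : Fin (n + 1) → CoordPoly n) (hQ : ∀ i, (Q i).IsHomogeneous (d i))
    (hgen : InGeneralPosition fun o => projZeros (withJacobian Q o)) :
    ∃ R : CoordPoly n,
      IsReducedEquation R (projEndo d Q hgen '' projZeros (jacobianPoly Q)) ∧
      ∃ Z : Set (CProj n), IsProperSubvariety Z (projZeros (jacobianPoly Q)) ∧
        ∀ f : ℂ → CProj n, IsEntireCurve f →
          ∀ z : ℂ, f z ∈ projZeros (jacobianPoly Q) \ Z →
            ordPullback f (jacobianPoly Q) z + 1 ≤ ordPullback (projEndo d Q hgen ∘ f) R z := by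
  have hlcm : Finset.univ.lcm d ≠ 0 := by
    rw [Ne, Finset.lcm_eq_zero_iff]
    rintro ⟨i, -, hi⟩
    exact absurd (hd i) (by omega)
  have hzero : ∀ x, (∀ i, eval x (endoPoly d Q i) = 0) → x = 0 := by
    intro x hx
    by_contra hx0
    obtain ⟨h, -⟩ := projEndo_mk hQ hgen hx0
    exact h ((eval_endoPoly x).symm.trans (funext hx))
  have hJ := jacobianPoly_isHomogeneous hQ
  have hJdvd := jacobianPoly_dvd_det (d := d) (Q := Q)
  have hJ0 : jacobianPoly Q ≠ 0 := ne_zero_of_dvd_ne_zero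
    (det_jacobianMatrix_ne_zero _ (aeval_isIntegral hlcm (endoPoly_isHomogeneous hQ) hzero)) hJdvd
  -- Positive degree makes `𝒱` nonempty, so that `∅` is a proper subset of it.
  have hJdeg : ∑ i, (d i - 1) ≠ 0 := by
    have h : ∑ i, (d i - 1) + (n + 1) = ∑ i, d i := by
      rw [← Finset.sum_congr rfl fun i _ => Nat.sub_add_cancel (hd i), Finset.sum_add_distrib]
      simp
    omega
  obtain ⟨R, ⟨l, hl⟩, hsq, hRzero, T, hT, hT0⟩ :=
    exists_reduced_equation_image hlcm (endoPoly_isHomogeneous hQ) hzero hJ hJdvd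
  -- `J * radical J` divides `R ∘ F`, so the inequality holds on all of `𝒱`: no exceptional set.
  refine ⟨R, ⟨⟨l, hl⟩, hsq, ?_⟩, ∅, ⟨⟨{1}, ?_, ?_⟩, ?_, ?_⟩, ?_⟩
  · ext y
    induction y using Projectivization.ind with
    | h y hy =>
    rw [mk_mem_projZeros hl, hRzero]
    constructor
    · rintro ⟨x, hx, hxy⟩
      have hxy' : endoVec d Q x = y := (eval_endoPoly x).symm.trans (funext hxy)
      have hx0 : x ≠ 0 := by
        rintro rfl
        apply hy
        -- Scaling by `0` shows that `G` maps the origin to the origin.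
        have h0 := endoVec_smul hQ 0 (0 : Fin (n + 1) → ℂ)
        rw [zero_smul, zero_pow hlcm, zero_smul] at h0
        rw [← hxy', h0]
      refine ⟨Projectivization.mk ℂ x hx0, (mk_mem_projZeros hJ hx0).2 hx, ?_⟩
      obtain ⟨h1, h2⟩ := projEndo_mk hQ hgen hx0
      rw [h2]
      congr 1
    · rintro ⟨p, hp, hpy⟩
      induction p using Projectivization.ind with
      | h x hx =>
      rw [mk_mem_projZeros hJ] at hp
      obtain ⟨h1, h2⟩ := projEndo_mk hQ hgen hx
      rw [h2] at hpy
      have h3 : Projectivization.mk ℂ y hy ∈ projZeros R := by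
        rw [← hpy, mk_mem_projZeros hl, hRzero]
        exact ⟨x, hp, fun i => congrFun (eval_endoPoly x) i⟩
      rwa [mk_mem_projZeros hl, hRzero] at h3
  · rintro _ rfl
    exact ⟨0, isHomogeneous_one _ _⟩
  · simp [projZeros]
  · have : Nontrivial (Fin (n + 1)) := Fin.nontrivial_iff_two_le.2 (by omega)
    obtain ⟨x, hx, hxJ⟩ := exists_ne_zero_eval_eq_zero hJ hJdeg hJ0
    exact Set.empty_ssubset.2 ⟨_, (mk_mem_projZeros hJ hx).2 hxJ⟩
  · intro S _ hS
    rwa [Set.sdiff_empty] at hS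
  · intro f hf z hz
    exact ordPullback_add_one_le hQ hgen hJ hl hT hT0 (hf z) hz.1
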